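/- Let $0\le r\le n$ be integers, $\mathbb X\subset\mathbb R^n$ Lebesgue measurable and $\mathbb Z\subset\mathbb R^r$ Borel measurable (e.g. a domain), and write $|\mathbb Z|$ for its Lebesgue measure (with $1/\infty=0$). Consider a continuous-time Markov process on $\mathbb X$ with measurable transition densities $p^t:\mathbb X\times\mathbb X\to[0,\infty)$, $t>0$, i.e. $P^t(x,B)=\int_{B\cap\mathbb X}p^t(x,y)\,dy$ are probability measures satisfying the Chapman--Kolmogorov equation. Assume that it has a unique stationary probability measure $\mu$, that $\mu$ has a continuous, strictly positive Lebesgue density $\pi$ on $\mathbb X$, and that $p^t(x,y)\pi(x)=p^t(y,x)\pi(y)$ for all $x,y\in\mathbb X$, $t>0$. A reaction coordinate is a map $\xi$ from $\mathbb R^n$ to $\mathbb R^r$ that is continuous on $\mathbb X$, maps $\mathbb X$ into $\mathbb Z$, and at almost every point of $\mathbb X$ is differentiable with derivative $\nabla\xi(x)^{\top}$ of full rank $r$. For $z\in\mathbb Z$ let $\Sigma_\xi(z)=\{x\in\mathbb X:\xi(x)=z\}$ and define on $\Sigma_\xi(z)$ the measures $$d\sigma^\xi_z=\det\big(\nabla\xi^{\top}\nabla\xi\big)^{-1/2}\,dH_{n-r},\qquad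 d\mu^\xi_z=\pi\,d\sigma^\xi_z ,$$ where $H_{n-r}$ is the $(n-r)$-dimensional Hausdorff measure (normalized to agree with Lebesgue measure on $\mathbb R^{n-r}$), and the weight is understood to be $0$ where $\xi$ is not differentiable with full rank. Let $\xi$ and $\vartheta$ be reaction coordinates, and let the process be $\varepsilon$-lumpable ($\varepsilon\ge 0$) with respect to $\xi$ with lag time $\tau>0$ and effective densities $p_L^t:\mathbb Z\times\mathbb X\to[0,\infty)$, i.e. the $p_L^t$ are measurable and $$\frac1{|\mathbb Z|}\int_{\mathbb X}\int_{\mathbb X}\big|p^t(x,y)-p_L^t(\xi(x),y)\big|\,dy\,d\mu(x)\le\varepsilon\qquad\text{for all }t\ge\tau .$$ With $p_L=p_L^\tau$, define $$f_L(z)=\frac1{|\mathbb Z|}\int_{\mathbb Z}\int_{\Sigma_\vartheta(z')}\int_{\Sigma_\vartheta(z')}\left|\frac{p_L(z,y_1)}{\pi(y_1)}-\frac{p_L(z,y_2)}{\pi(y_2)}\right|d\mu^\vartheta_{z'}(y_1)\,d\mu^\vartheta_{z'}(y_2)\,dz'$$ (set to $0$ where this is infinite), and let $\bar\mu$ be the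 measure on $\mathbb Z$ with Lebesgue density $\bar\pi(z)=\int_{\Sigma_\xi(z)}\pi\,d\sigma^\xi_z$. Then $\bar\mu$ is a probability measure, $f_L\circ\xi\in L^2(\mu)$ if and only if $f_L\in L^2(\bar\mu)$, and $$\operatorname{Var}_\mu(f_L\circ\xi)=\operatorname{Var}_{\bar\mu}(f_L),$$ where $\operatorname{Var}_\nu(g)=\int (g-\int g\,d\nu)^2\,d\nu$ if $g\in L^2(\nu)$ (and, by convention, $\operatorname{Var}_\nu(g)=0$ otherwise). -/

import Mathlib

open MeasureTheory
open scoped ENNReal NNReal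

namespace ReactionCoordinate

noncomputable section

variable {n r : ℕ}

/-- The measure `μ` on the state space `X ⊆ ℝⁿ` with Lebesgue density `π`
(a Borel measure on `ℝⁿ` that is carried by `X`). -/
def stationaryMeasure (X : Set (EuclideanSpace ℝ (Fin n))) (π : EuclideanSpace ℝ (Fin n) → ℝ) :
    Measure (EuclideanSpace ℝ (Fin n)) :=
  (volume.restrict X).withDensity fun x => ENNReal.ofReal (π x)

/-- The transition probability `Pᵗ(x, ·)`, with density `pᵗ(x, ·)` on `X`. -/
def transitionMeasure (X : Set (EuclideanSpace ℝ (Fin n)))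
    (p : ℝ → EuclideanSpace ℝ (Fin n) → EuclideanSpace ℝ (Fin n) → ℝ) (t : ℝ)
    (x : EuclideanSpace ℝ (Fin n)) : Measure (EuclideanSpace ℝ (Fin n)) :=
  (volume.restrict X).withDensity fun y => ENNReal.ofReal (p t x y)

/-- `ν` is stationary for the transition function with densities `pᵗ`. -/
def IsStationary (X : Set (EuclideanSpace ℝ (Fin n)))
    (p : ℝ → EuclideanSpace ℝ (Fin n) → EuclideanSpace ℝ (Fin n) → ℝ)
    (ν : Measure (EuclideanSpace ℝ (Fin n))) : Prop :=
  ∀ t : ℝ, 0 < t → ∀ B : Set (EuclideanSpace ℝ (Fin n)), MeasurableSet B →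
    ∫⁻ x in X, transitionMeasure X p t x B ∂ν = ν B

/-- A continuous-time Markov process on the Lebesgue-measurable set `X ⊆ ℝⁿ`, given by its
transition densities `pᵗ`, `t > 0`, which is reversible with respect to a continuous and strictly
positive density `π`, the density of its unique stationary probability measure.
Only the values of `π` on `X` and of `pᵗ` on `X × X` are constrained. -/
structure IsReversibleSystem (X : Set (EuclideanSpace ℝ (Fin n)))
    (π : EuclideanSpace ℝ (Fin n) → ℝ)
    (p : ℝ → EuclideanSpace ℝ (Fin n) → EuclideanSpace ℝ (Fin n) → ℝ) : Prop where
  nullMeasurableSet : NullMeasurableSet X volume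
  continuousOn_density : ContinuousOn π X
  density_pos : ∀ x ∈ X, 0 < π x
  isProbabilityMeasure : IsProbabilityMeasure (stationaryMeasure X π)
  measurable_transition : ∀ t : ℝ, 0 < t → Measurable fun q : X × X => p t q.1 q.2
  transition_nonneg : ∀ t : ℝ, 0 < t → ∀ x ∈ X, ∀ y ∈ X, 0 ≤ p t x y
  transition_prob : ∀ t : ℝ, 0 < t → ∀ x ∈ X, IsProbabilityMeasure (transitionMeasure X p t x)
  chapman_kolmogorov : ∀ s t : ℝ, 0 < s → 0 < t → ∀ x ∈ X,
    ∀ B : Set (EuclideanSpace ℝ (Fin n)), MeasurableSet B →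
      transitionMeasure X p (s + t) x B =
        ∫⁻ u in X, transitionMeasure X p t u B ∂(transitionMeasure X p s x)
  stationary_unique : ∀ ν : Measure (EuclideanSpace ℝ (Fin n)), IsProbabilityMeasure ν →
    ν Xᶜ = 0 → (IsStationary X p ν ↔ ν = stationaryMeasure X π)
  detailed_balance : ∀ t : ℝ, 0 < t → ∀ x ∈ X, ∀ y ∈ X, p t x y * π x = p t y x * π y

/-- A reaction coordinate: a continuous map from `X` to `Z ⊆ ℝʳ` whose derivative exists and has
full rank `r` at almost every point of `X`. -/
structure IsReactionCoordinate (X : Set (EuclideanSpace ℝ (Fin n)))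
    (Z : Set (EuclideanSpace ℝ (Fin r)))
    (ξ : EuclideanSpace ℝ (Fin n) → EuclideanSpace ℝ (Fin r)) : Prop where
  continuousOn : ContinuousOn ξ X
  mapsTo : Set.MapsTo ξ X Z
  regular : ∀ᵐ x ∂(volume.restrict X),
    DifferentiableAt ℝ ξ x ∧ Function.Surjective (fderiv ℝ ξ x)

/-- The level set `{x ∈ X | ξ(x) = z}`. -/
def levelSet (X : Set (EuclideanSpace ℝ (Fin n)))
    (ξ : EuclideanSpace ℝ (Fin n) → EuclideanSpace ℝ (Fin r)) (z : EuclideanSpace ℝ (Fin r)) :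
    Set (EuclideanSpace ℝ (Fin n)) :=
  {x | x ∈ X ∧ ξ x = z}

/-- The factor `det(∇ξ(x)ᵀ ∇ξ(x))^(-1/2)`, where `∇ξ(x)ᵀ` is the derivative of `ξ` at `x`.
It is `0` at the points where the determinant vanishes. -/
def coareaWeight (ξ : EuclideanSpace ℝ (Fin n) → EuclideanSpace ℝ (Fin r))
    (x : EuclideanSpace ℝ (Fin n)) : ℝ :=
  (Real.sqrt (fderiv ℝ ξ x ∘L ContinuousLinearMap.adjoint (fderiv ℝ ξ x)).det)⁻¹

/-- The surface measure `dσ_z = det(∇ξᵀ ∇ξ)^(-1/2) dH_{n-r}` on the `z`-level set of `ξ`;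
`μHE[d]` is the `d`-dimensional Hausdorff measure, normalized to be Lebesgue measure on `ℝᵈ`. -/
def surfaceMeasure (X : Set (EuclideanSpace ℝ (Fin n)))
    (ξ : EuclideanSpace ℝ (Fin n) → EuclideanSpace ℝ (Fin r)) (z : EuclideanSpace ℝ (Fin r)) :
    Measure (EuclideanSpace ℝ (Fin n)) :=
  (μHE[n - r].restrict (levelSet X ξ z)).withDensity fun x => ENNReal.ofReal (coareaWeight ξ x)

/-- The marginal stationary measure `dμ_z = π dσ_z` on the `z`-level set of `ξ`. -/
def marginalMeasure (X : Set (EuclideanSpace ℝ (Fin n))) (π : EuclideanSpace ℝ (Fin n) → ℝ)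
    (ξ : EuclideanSpace ℝ (Fin n) → EuclideanSpace ℝ (Fin r)) (z : EuclideanSpace ℝ (Fin r)) :
    Measure (EuclideanSpace ℝ (Fin n)) :=
  (surfaceMeasure X ξ z).withDensity fun x => ENNReal.ofReal (π x)

/-- The effective invariant density `π̄(z) = ∫_{Σ_ξ(z)} π dσ_z`. -/
def effectiveDensity (X : Set (EuclideanSpace ℝ (Fin n))) (π : EuclideanSpace ℝ (Fin n) → ℝ)
    (ξ : EuclideanSpace ℝ (Fin n) → EuclideanSpace ℝ (Fin r)) (z : EuclideanSpace ℝ (Fin r)) :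
    ℝ≥0∞ :=
  ∫⁻ x, ENNReal.ofReal (π x) ∂(surfaceMeasure X ξ z)

/-- The effective measure `μ̄` on `Z`, with Lebesgue density `π̄`. -/
def effectiveMeasure (X : Set (EuclideanSpace ℝ (Fin n))) (Z : Set (EuclideanSpace ℝ (Fin r)))
    (π : EuclideanSpace ℝ (Fin n) → ℝ)
    (ξ : EuclideanSpace ℝ (Fin n) → EuclideanSpace ℝ (Fin r)) :
    Measure (EuclideanSpace ℝ (Fin r)) :=
  (volume.restrict Z).withDensity (effectiveDensity X π ξ)

/-- The system with transition densities `pᵗ` is `ε`-lumpable with respect to `ξ`, with lag time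
`τ` and effective densities `p_Lᵗ : Z × X → ℝ⁺`: for all `t ≥ τ`,
`|Z|⁻¹ ∫_X ∫_X |pᵗ(x,y) - p_Lᵗ(ξ(x),y)| dy dμ(x) ≤ ε`. -/
structure IsLumpable (X : Set (EuclideanSpace ℝ (Fin n))) (Z : Set (EuclideanSpace ℝ (Fin r)))
    (π : EuclideanSpace ℝ (Fin n) → ℝ)
    (p : ℝ → EuclideanSpace ℝ (Fin n) → EuclideanSpace ℝ (Fin n) → ℝ)
    (ξ : EuclideanSpace ℝ (Fin n) → EuclideanSpace ℝ (Fin r)) (ε : ℝ≥0) (τ : ℝ)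
    (pL : ℝ → EuclideanSpace ℝ (Fin r) → EuclideanSpace ℝ (Fin n) → ℝ) : Prop where
  lag_pos : 0 < τ
  measurable : ∀ t : ℝ, τ ≤ t → Measurable fun q : Z × X => pL t q.1 q.2
  nonneg : ∀ t : ℝ, τ ≤ t → ∀ z ∈ Z, ∀ y ∈ X, 0 ≤ pL t z y
  bound : ∀ t : ℝ, τ ≤ t →
    (volume Z)⁻¹ *
      ∫⁻ x, (∫⁻ y in X, ENNReal.ofReal |p t x y - pL t (ξ x) y|) ∂(stationaryMeasure X π)
      ≤ (ε : ℝ≥0∞)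

/-- The function
`f_L(z) = |Z|⁻¹ ∫_Z ∫_{Σ_ϑ(z')} ∫_{Σ_ϑ(z')}
  |p_L(z,y₁)/π(y₁) - p_L(z,y₂)/π(y₂)| dμ_{z'}(y₁) dμ_{z'}(y₂) dz'`
(with value `0` at those `z` for which the integral is infinite). -/
def effectiveIntegrand (X : Set (EuclideanSpace ℝ (Fin n))) (Z : Set (EuclideanSpace ℝ (Fin r)))
    (π : EuclideanSpace ℝ (Fin n) → ℝ)
    (ϑ : EuclideanSpace ℝ (Fin n) → EuclideanSpace ℝ (Fin r))
    (pL : EuclideanSpace ℝ (Fin r) → EuclideanSpace ℝ (Fin n) → ℝ)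
    (z : EuclideanSpace ℝ (Fin r)) : ℝ :=
  ((volume Z)⁻¹ *
    ∫⁻ z' in Z, ∫⁻ y₂, ∫⁻ y₁, ENNReal.ofReal |pL z y₁ / π y₁ - pL z y₂ / π y₂|
      ∂(marginalMeasure X π ϑ z') ∂(marginalMeasure X π ϑ z')).toReal

end

end ReactionCoordinate

/-! ### Linear algebra: completing a surjection to an automorphism with the coarea Jacobian -/

section CoareaLinear

open Filter Topology Module

variable {n r : ℕ}

/-! The effective measure is the image of `μ` under `ξ`; once this is known, the theorem is a change
of variables, whatever function stands in the place of `f_L`.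

That the image has density `π̄` is the coarea formula, proved here for a map that is only
differentiable with surjective derivative on the set considered
(`measurable_fiberMeasure_and_lintegral_eq_volume`). On a small piece `f` is nearly a linear
surjection `A`. Adding the orthogonal projection to `ker A` as further coordinates gives a map to
`ℝⁿ` that is nearly linear with Jacobian `√det(A A*)`. The volume of its image is given by Fubini,
and the projection is nearly isometric on the fibers of `f`. This yields the formula up to a factor
`c > 1`; sum over countably many pieces and let `c → 1`.

The change of variables has to work without measurability of `f_L`. Since `ξ` is continuous on a
Borel set of full measure and finite measures on `ℝⁿ` are inner regular, sets whose preimage is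
null-measurable are null-measurable for the image measure, and lower integrals of arbitrary
functions are preserved (`aemeasurable_map_iff_of_continuousOn`, `lintegral_map_of_continuousOn`).
-/

lemma exists_linearIsometry_range_eq_ker (hr : r ≤ n)
    (A : EuclideanSpace ℝ (Fin n) →L[ℝ] EuclideanSpace ℝ (Fin r)) (hA : Function.Surjective A) :
    ∃ i : EuclideanSpace ℝ (Fin (n - r)) →ₗᵢ[ℝ] EuclideanSpace ℝ (Fin n),
      ∀ x, A x = 0 ↔ x ∈ Set.range i := by
  have hfin : finrank ℝ (LinearMap.ker A.toLinearMap) = n - r := by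
    have h := A.toLinearMap.finrank_range_add_finrank_ker
    rw [LinearMap.range_eq_top.2 hA, finrank_top] at h
    simp only [finrank_euclideanSpace, Fintype.card_fin] at h
    omega
  let e := ((stdOrthonormalBasis ℝ (LinearMap.ker A.toLinearMap)).reindex (finCongr hfin)).repr
  refine ⟨(LinearMap.ker A.toLinearMap).subtypeₗᵢ.comp e.symm.toLinearIsometry, fun x => ?_⟩
  constructor
  · intro hx
    exact ⟨e ⟨x, hx⟩, by simp⟩
  · rintro ⟨y, rfl⟩
    exact (e.symm y).2

lemma exists_linearIsometryEquiv_prod (hr : r ≤ n) :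
    Nonempty (EuclideanSpace ℝ (Fin n) ≃ₗᵢ[ℝ]
      WithLp 2 (EuclideanSpace ℝ (Fin r) × EuclideanSpace ℝ (Fin (n - r)))) := by
  have h : finrank ℝ (WithLp 2 (EuclideanSpace ℝ (Fin r) × EuclideanSpace ℝ (Fin (n - r)))) = n := by
    rw [(WithLp.linearEquiv 2 ℝ _).finrank_eq, finrank_prod, finrank_euclideanSpace_fin,
      finrank_euclideanSpace_fin]
    omega
  exact ⟨((stdOrthonormalBasis ℝ _).reindex (finCongr h)).repr.symm⟩

/-- A map that completes `A` to an isomorphism when `A` is surjective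
and `i` is an isometry onto the kernel of `A`. -/
noncomputable def adaptedMap
    (J : EuclideanSpace ℝ (Fin n) ≃ₗᵢ[ℝ]
      WithLp 2 (EuclideanSpace ℝ (Fin r) × EuclideanSpace ℝ (Fin (n - r))))
    (A : EuclideanSpace ℝ (Fin n) →L[ℝ] EuclideanSpace ℝ (Fin r))
    (i : EuclideanSpace ℝ (Fin (n - r)) →ₗᵢ[ℝ] EuclideanSpace ℝ (Fin n)) :
    EuclideanSpace ℝ (Fin n) →L[ℝ] EuclideanSpace ℝ (Fin n) :=
  (J.symm.toContinuousLinearEquiv.toContinuousLinearMap ∘L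
    (WithLp.prodContinuousLinearEquiv 2 ℝ (EuclideanSpace ℝ (Fin r))
      (EuclideanSpace ℝ (Fin (n - r)))).symm.toContinuousLinearMap) ∘L
    A.prod (ContinuousLinearMap.adjoint i.toContinuousLinearMap)

lemma adaptedMap_apply
    (J : EuclideanSpace ℝ (Fin n) ≃ₗᵢ[ℝ]
      WithLp 2 (EuclideanSpace ℝ (Fin r) × EuclideanSpace ℝ (Fin (n - r))))
    (A : EuclideanSpace ℝ (Fin n) →L[ℝ] EuclideanSpace ℝ (Fin r))
    (i : EuclideanSpace ℝ (Fin (n - r)) →ₗᵢ[ℝ] EuclideanSpace ℝ (Fin n)) (x) :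
    adaptedMap J A i x =
      J.symm (WithLp.toLp 2 (A x, ContinuousLinearMap.adjoint i.toContinuousLinearMap x)) := rfl

lemma adjoint_apply_linearIsometry (i : EuclideanSpace ℝ (Fin (n - r)) →ₗᵢ[ℝ] EuclideanSpace ℝ (Fin n)) (g) :
    ContinuousLinearMap.adjoint i.toContinuousLinearMap (i g) = g := by
  refine ext_inner_right ℝ fun y => ?_
  rw [ContinuousLinearMap.adjoint_inner_left]
  exact i.inner_map_map g y

/-- With `M = J⁻¹ (A, i*)`, the relations `A i = 0` and `i* i = 1` make `M M*` conjugate to `A A* ⊕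
1`. Hence `|det M|` is the coarea Jacobian. -/
lemma det_adaptedMap_sq
    (J : EuclideanSpace ℝ (Fin n) ≃ₗᵢ[ℝ]
      WithLp 2 (EuclideanSpace ℝ (Fin r) × EuclideanSpace ℝ (Fin (n - r))))
    (A : EuclideanSpace ℝ (Fin n) →L[ℝ] EuclideanSpace ℝ (Fin r))
    (i : EuclideanSpace ℝ (Fin (n - r)) →ₗᵢ[ℝ] EuclideanSpace ℝ (Fin n))
    (hi : ∀ x, A x = 0 ↔ x ∈ Set.range i) :
    (adaptedMap J A i).det ^ 2 = (A ∘L ContinuousLinearMap.adjoint A).det := by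
  set P := ContinuousLinearMap.adjoint i.toContinuousLinearMap with hP
  set M := adaptedMap J A i with hM
  have hadj : ∀ y, ContinuousLinearMap.adjoint M y =
      ContinuousLinearMap.adjoint A (J y).fst + i (J y).snd := by
    intro y
    refine ext_inner_left ℝ fun x => ?_
    rw [ContinuousLinearMap.adjoint_inner_right, hM, adaptedMap_apply, inner_add_right,
      ContinuousLinearMap.adjoint_inner_right, ← J.inner_map_map, J.apply_symm_apply,
      WithLp.prod_inner_apply]
    congr 1
    exact ContinuousLinearMap.adjoint_inner_left _ _ _
  have hPA : ∀ f, P (ContinuousLinearMap.adjoint A f) = 0 := by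
    intro f
    refine ext_inner_right ℝ fun y => ?_
    rw [hP, ContinuousLinearMap.adjoint_inner_left, ContinuousLinearMap.adjoint_inner_left,
      inner_zero_left]
    have : A (i y) = 0 := (hi _).2 ⟨y, rfl⟩
    simp [this]
  have hcomp : (M ∘L ContinuousLinearMap.adjoint M : _ →L[ℝ] _).toLinearMap =
      ((WithLp.linearEquiv 2 ℝ _).symm.trans J.symm.toLinearEquiv).conj
        ((A ∘L ContinuousLinearMap.adjoint A).toLinearMap.prodMap LinearMap.id) := by
    ext1 y
    have h1 : A (i (J y).snd) = 0 := (hi _).2 ⟨_, rfl⟩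
    change M (ContinuousLinearMap.adjoint M y) = J.symm (WithLp.toLp 2
      (A (ContinuousLinearMap.adjoint A (J y).fst), (J y).snd))
    rw [hadj, hM, adaptedMap_apply, map_add, map_add, h1, ← hP, hPA, hP,
      adjoint_apply_linearIsometry, add_zero, zero_add]
  have h1 := M.normDet_sq
  have h2 : (ContinuousLinearMap.adjoint M ∘L M).det = (M ∘L ContinuousLinearMap.adjoint M).det := by
    simp only [ContinuousLinearMap.det, ContinuousLinearMap.toLinearMap_comp, LinearMap.det_comp]
    ring
  rw [h2, LinearMap.normDet_eq_abs_det, ContinuousLinearMap.det, hcomp, LinearEquiv.conj_apply,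
    LinearMap.comp_assoc, LinearMap.det_conj, LinearMap.det_prodMap, LinearMap.det_id, mul_one,
    sq_abs] at h1
  exact h1

end CoareaLinear

/-! ### Slices of a set on which the map is nearly linear -/

section CoareaPiece

open Filter Topology Module

variable {n r : ℕ}

lemma norm_adjoint_linearIsometry_le
    (i : EuclideanSpace ℝ (Fin (n - r)) →ₗᵢ[ℝ] EuclideanSpace ℝ (Fin n)) (x) :
    ‖ContinuousLinearMap.adjoint i.toContinuousLinearMap x‖ ≤ ‖x‖ := by
  refine (ContinuousLinearMap.le_opNorm _ _).trans ?_
  rw [LinearIsometryEquiv.norm_map]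
  exact mul_le_of_le_one_left (norm_nonneg _) i.norm_toContinuousLinearMap_le

/-- With a right inverse `R` of `A`, `x - R (A x)` lies in `ker A`, where `i*` is isometric. So `i*`
almost preserves the length of vectors that `A` almost kills. -/
lemma exists_norm_le_adjoint_add
    (A : EuclideanSpace ℝ (Fin n) →L[ℝ] EuclideanSpace ℝ (Fin r)) (hA : Function.Surjective A)
    (i : EuclideanSpace ℝ (Fin (n - r)) →ₗᵢ[ℝ] EuclideanSpace ℝ (Fin n))
    (hi : ∀ x, A x = 0 ↔ x ∈ Set.range i) :
    ∃ C : ℝ≥0, ∀ x,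
      ‖x‖ ≤ ‖ContinuousLinearMap.adjoint i.toContinuousLinearMap x‖ + C * ‖A x‖ := by
  obtain ⟨R, hR⟩ := A.exists_rightInverse_of_surjective (LinearMap.range_eq_top.2 hA)
  refine ⟨2 * ‖R‖₊, fun x => ?_⟩
  set P := ContinuousLinearMap.adjoint i.toContinuousLinearMap with hP
  have hk : A (x - R (A x)) = 0 := by
    have := congr($hR (A x))
    simp only [ContinuousLinearMap.comp_apply, ContinuousLinearMap.id_apply] at this
    rw [map_sub, this, sub_self]
  obtain ⟨g, hg⟩ := (hi _).1 hk
  have h1 : ‖x - R (A x)‖ = ‖P (x - R (A x))‖ := by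
    rw [← hg, hP, adjoint_apply_linearIsometry, i.norm_map]
  have h2 : ‖P (x - R (A x))‖ ≤ ‖P x‖ + ‖R (A x)‖ := by
    rw [map_sub]
    exact (norm_sub_le _ _).trans (add_le_add_right (norm_adjoint_linearIsometry_le i _) _)
  have h3 : ‖x‖ ≤ ‖x - R (A x)‖ + ‖R (A x)‖ := by
    simpa using norm_add_le (x - R (A x)) (R (A x))
  have h4 := R.le_opNorm (A x)
  push_cast
  linarith

lemma det_comp_adjoint_ne_zero_iff
    (A : EuclideanSpace ℝ (Fin n) →L[ℝ] EuclideanSpace ℝ (Fin r)) :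
    (A ∘L ContinuousLinearMap.adjoint A).det ≠ 0 ↔ Function.Surjective A := by
  rw [ContinuousLinearMap.det, ne_eq, LinearMap.det_eq_zero_iff_ker_ne_bot, not_not]
  constructor
  · intro h
    exact Function.Surjective.of_comp
      (LinearMap.injective_iff_surjective.1 (LinearMap.ker_eq_bot.1 h))
  · intro h
    rw [LinearMap.ker_eq_bot']
    intro y hy
    have h1 : ContinuousLinearMap.adjoint A y = 0 := by
      rw [← inner_self_eq_zero (𝕜 := ℝ), ContinuousLinearMap.adjoint_inner_left]
      rw [show A (ContinuousLinearMap.adjoint A y) = 0 from hy, inner_zero_right]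
    obtain ⟨x, rfl⟩ := h y
    rw [← inner_self_eq_zero (𝕜 := ℝ), ← ContinuousLinearMap.adjoint_inner_right, h1,
      inner_zero_right]

lemma det_comp_adjoint_pos (hr : r ≤ n)
    (A : EuclideanSpace ℝ (Fin n) →L[ℝ] EuclideanSpace ℝ (Fin r)) (hA : Function.Surjective A) :
    0 < (A ∘L ContinuousLinearMap.adjoint A).det := by
  obtain ⟨i, hi⟩ := exists_linearIsometry_range_eq_ker hr A hA
  obtain ⟨J⟩ := exists_linearIsometryEquiv_prod hr
  refine lt_of_le_of_ne ?_ ((det_comp_adjoint_ne_zero_iff A).2 hA).symm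
  rw [← det_adaptedMap_sq J A i hi]
  positivity

lemma euclideanHausdorffMeasure_image_le_of_lipschitzOnWith {E F : Type*}
    [MeasurableSpace E] [EMetricSpace E] [BorelSpace E]
    [MeasurableSpace F] [EMetricSpace F] [BorelSpace F] {f : E → F} {s : Set E} {K : ℝ≥0}
    (h : LipschitzOnWith K f s) (d : ℕ) : μHE[d] (f '' s) ≤ (K : ℝ≥0∞) ^ d * μHE[d] s := by
  simp only [Measure.euclideanHausdorffMeasure_def, Measure.smul_apply, ENNReal.smul_def,
    smul_eq_mul]
  have := h.hausdorffMeasure_image_le d.cast_nonneg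
  rw [ENNReal.rpow_natCast] at this
  calc _ ≤ _ * _ := mul_le_mul_right this _
    _ = _ := by ring

lemma euclideanHausdorffMeasure_le_of_antilipschitz {E F : Type*}
    [MeasurableSpace E] [EMetricSpace E] [BorelSpace E]
    [MeasurableSpace F] [EMetricSpace F] [BorelSpace F] {f : E → F} {s : Set E} {K : ℝ≥0}
    (h : ∀ x ∈ s, ∀ y ∈ s, edist x y ≤ K * edist (f x) (f y)) (d : ℕ) :
    μHE[d] s ≤ (K : ℝ≥0∞) ^ d * μHE[d] (f '' s) := by
  rcases s.eq_empty_or_nonempty with rfl | ⟨x₀, -⟩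
  · simp
  have : Nonempty E := ⟨x₀⟩
  have hinj : Set.InjOn f s := fun x hx y hy hxy => by
    simpa [hxy] using h x hx y hy
  have hl : LipschitzOnWith K (Function.invFunOn f s) (f '' s) := by
    rintro _ ⟨x, hx, rfl⟩ _ ⟨y, hy, rfl⟩
    rw [hinj.leftInvOn_invFunOn hx, hinj.leftInvOn_invFunOn hy]
    exact h x hx y hy
  have := euclideanHausdorffMeasure_image_le_of_lipschitzOnWith hl d
  rwa [hinj.leftInvOn_invFunOn.image_image] at this

/-- Fubini for the image of `S` under `(f, P)`, which is Borel as the injective continuous image of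
a Borel set. The isometry `J` only turns the product into `ℝⁿ`, so that determinants of
endomorphisms apply. -/
lemma volume_image_prodMk_eq_lintegral
    (J : EuclideanSpace ℝ (Fin n) ≃ₗᵢ[ℝ]
      WithLp 2 (EuclideanSpace ℝ (Fin r) × EuclideanSpace ℝ (Fin (n - r))))
    {f : EuclideanSpace ℝ (Fin n) → EuclideanSpace ℝ (Fin r)}
    {P : EuclideanSpace ℝ (Fin n) → EuclideanSpace ℝ (Fin (n - r))}
    {S : Set (EuclideanSpace ℝ (Fin n))} (hS : MeasurableSet S) (hf : ContinuousOn f S)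
    (hP : ContinuousOn P S) (hinj : Set.InjOn (fun x => (f x, P x)) S) :
    Measurable (fun z => volume (P '' (S ∩ f ⁻¹' {z}))) ∧
    ∫⁻ z, volume (P '' (S ∩ f ⁻¹' {z})) =
      volume ((fun x => J.symm (WithLp.toLp 2 (f x, P x))) '' S) := by
  have hm : MeasurableSet ((fun x => (f x, P x)) '' S) :=
    hS.image_of_continuousOn_injOn (hf.prodMk hP) hinj
  have hslice : ∀ z, P '' (S ∩ f ⁻¹' {z}) = Prod.mk z ⁻¹' ((fun x => (f x, P x)) '' S) := by
    intro z
    ext g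
    simp only [Set.mem_image, Set.mem_inter_iff, Set.mem_preimage, Set.mem_singleton_iff,
      Prod.mk.injEq, and_assoc]
  have hmp : MeasurePreserving
      (fun q : EuclideanSpace ℝ (Fin r) × EuclideanSpace ℝ (Fin (n - r)) =>
        J.symm (WithLp.toLp 2 q)) :=
    J.symm.measurePreserving.comp (WithLp.volume_preserving_toLp _ _)
  have hemb : MeasurableEmbedding
      (fun q : EuclideanSpace ℝ (Fin r) × EuclideanSpace ℝ (Fin (n - r)) =>
        J.symm (WithLp.toLp 2 q)) :=
    ((MeasurableEquiv.toLp 2 _).trans J.symm.toMeasurableEquiv).measurableEmbedding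
  simp only [hslice]
  refine ⟨measurable_measure_prodMk_left hm, ?_⟩
  rw [← Measure.prod_apply hm, ← Measure.volume_eq_prod,
    ← hmp.measure_preimage_emb hemb]
  congr 1
  rw [← Set.image_image (fun q => J.symm (WithLp.toLp 2 q)) (fun x => (f x, P x)),
    hemb.injective.preimage_image]

/-- The function `g` is the volume of the projected slice. It is measurable by Fubini, which is not
clear for the Hausdorff measure of the slice itself. -/
lemma exists_slice_volume_of_approximatesLinearOn (hr : r ≤ n)
    (A : EuclideanSpace ℝ (Fin n) →L[ℝ] EuclideanSpace ℝ (Fin r)) (hA : Function.Surjective A)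
    {c : ℝ≥0} (hc : 1 < c) :
    ∃ δ : ℝ≥0, δ ≠ 0 ∧ ∀ (f : EuclideanSpace ℝ (Fin n) → EuclideanSpace ℝ (Fin r))
      (S : Set (EuclideanSpace ℝ (Fin n))), MeasurableSet S → ApproximatesLinearOn f A S δ →
      ∃ g : EuclideanSpace ℝ (Fin r) → ℝ≥0∞, Measurable g ∧
        (∀ z, g z ≤ μHE[n - r] (S ∩ f ⁻¹' {z})) ∧
        (∀ z, μHE[n - r] (S ∩ f ⁻¹' {z}) ≤ c * g z) ∧
        ∫⁻ z, g z ≤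
          c * (ENNReal.ofReal (√(A ∘L ContinuousLinearMap.adjoint A).det) * volume S) ∧
        ENNReal.ofReal (√(A ∘L ContinuousLinearMap.adjoint A).det) * volume S ≤
          c * ∫⁻ z, g z := by
  obtain ⟨i, hi⟩ := exists_linearIsometry_range_eq_ker hr A hA
  obtain ⟨J⟩ := exists_linearIsometryEquiv_prod hr
  obtain ⟨C, hC⟩ := exists_norm_le_adjoint_add A hA i hi
  have hdet := det_adaptedMap_sq J A i hi
  set P := ContinuousLinearMap.adjoint i.toContinuousLinearMap with hP
  have hd : √(A ∘L ContinuousLinearMap.adjoint A).det = |(adaptedMap J A i).det| := by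
    rw [← hdet, Real.sqrt_sq_eq_abs]
  have hne : (adaptedMap J A i).det ≠ 0 := by
    intro h0
    rw [h0, zero_pow two_ne_zero] at hdet
    exact (det_comp_adjoint_ne_zero_iff A).2 hA hdet.symm
  rw [hd]
  set d : ℝ≥0 := ⟨|(adaptedMap J A i).det|, abs_nonneg _⟩ with hd'
  have hdpos : 0 < d := abs_pos.2 hne
  have hdd : ENNReal.ofReal |(adaptedMap J A i).det| = d := by
    rw [hd', ENNReal.ofReal, Real.toNNReal_of_nonneg (abs_nonneg _)]
    rfl
  have hup := addHaar_image_le_mul_of_det_lt volume (adaptedMap J A i) (m := c * d) (by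
    rw [hdd]
    exact_mod_cast lt_mul_of_one_lt_left hdpos hc)
  have hlow := mul_le_addHaar_image_of_lt_det volume (adaptedMap J A i) (m := c⁻¹ * d) (by
    rw [hdd]
    exact_mod_cast mul_lt_of_lt_one_left hdpos (inv_lt_one_of_one_lt₀ hc))
  -- A distortion `K` of lengths costs `K ^ (n - r)` in the Hausdorff measure of a slice.
  obtain ⟨K, hK1, hKc⟩ : ∃ K : ℝ≥0, 1 < K ∧ K ^ (n - r) ≤ c := by
    have h1 : Tendsto (fun K : ℝ≥0 => K ^ (n - r)) (𝓝[>] 1) (𝓝 1) :=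
      ((continuous_pow (n - r)).tendsto' 1 1 (one_pow _)).mono_left nhdsWithin_le_nhds
    have h2 := (h1.eventually (ge_mem_nhds hc)).and self_mem_nhdsWithin
    obtain ⟨K, h3, h4⟩ := h2.exists
    exact ⟨K, h4, h3⟩
  -- This bound lets the error `C δ ‖x - y‖` be absorbed on the left in `hanti`, leaving `K⁻¹ ‖x -
  -- y‖`.
  have hsmall : ∀ᶠ δ in 𝓝[>] (0 : ℝ≥0), C * δ ≤ 1 - K⁻¹ := by
    have h1 : Tendsto (fun δ : ℝ≥0 => C * δ) (𝓝[>] 0) (𝓝 0) :=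
      ((continuous_const_mul C).tendsto' 0 0 (mul_zero _)).mono_left nhdsWithin_le_nhds
    exact h1.eventually (ge_mem_nhds (tsub_pos_of_lt (inv_lt_one_of_one_lt₀ hK1)))
  obtain ⟨δ, ⟨⟨hδup, hδlow⟩, hδsmall⟩, hδpos⟩ :=
    (((hup.and hlow).and hsmall).and self_mem_nhdsWithin).exists
  refine ⟨δ, ne_of_gt hδpos, fun f S hS hf => ?_⟩
  have hanti : ∀ x ∈ S, ∀ y ∈ S, f x = f y → ‖x - y‖ ≤ K * ‖P x - P y‖ := by
    intro x hx y hy hxy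
    have h1 := hf x hx y hy
    rw [hxy, sub_self, zero_sub, norm_neg] at h1
    have h2 := hC (x - y)
    have h3 : (C : ℝ) * ‖A (x - y)‖ ≤ (1 - (K : ℝ)⁻¹) * ‖x - y‖ := by
      calc (C : ℝ) * ‖A (x - y)‖ ≤ C * (δ * ‖x - y‖) := by gcongr
        _ = (C * δ) * ‖x - y‖ := by ring
        _ ≤ _ := by
          gcongr
          have : ((C * δ : ℝ≥0) : ℝ) ≤ ((1 - K⁻¹ : ℝ≥0) : ℝ) := by exact_mod_cast hδsmall
          rwa [NNReal.coe_sub (inv_lt_one_of_one_lt₀ hK1).le] at this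
    have hKpos : (0 : ℝ) < K := by exact_mod_cast zero_lt_one.trans hK1
    rw [← map_sub]
    have h4 : (K : ℝ)⁻¹ * ‖x - y‖ ≤ ‖P (x - y)‖ := by linarith
    rwa [inv_mul_le_iff₀ hKpos] at h4
  have hinj : Set.InjOn (fun x => (f x, P x)) S := by
    intro x hx y hy hxy
    obtain ⟨h1, h2⟩ := Prod.mk.inj hxy
    have := hanti x hx y hy h1
    rw [h2, sub_self, norm_zero, mul_zero] at this
    exact sub_eq_zero.1 (norm_le_zero_iff.1 this)
  obtain ⟨hmeas, hint⟩ := volume_image_prodMk_eq_lintegral J hS hf.continuousOn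
    P.continuous.continuousOn hinj
  -- The second component is linear, so the whole error comes from `f`.
  have happrox : ApproximatesLinearOn (fun x => J.symm (WithLp.toLp 2 (f x, P x)))
      (adaptedMap J A i) S δ := by
    intro x hx y hy
    rw [adaptedMap_apply, ← map_sub, ← map_sub, LinearIsometryEquiv.norm_map,
      ← WithLp.toLp_sub, ← WithLp.toLp_sub]
    have : ((f x, P x) - (f y, P y) - (A (x - y), P (x - y)) :
        EuclideanSpace ℝ (Fin r) × EuclideanSpace ℝ (Fin (n - r))) =
        (f x - f y - A (x - y), 0) := by
      simp
    rw [this, WithLp.norm_toLp_fst]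
    exact hf x hx y hy
  refine ⟨_, hmeas, fun z => ?_, fun z => ?_, ?_, ?_⟩
  · rw [← EuclideanSpace.euclideanHausdorffMeasure_eq_volume]
    have hl : LipschitzOnWith 1 P (S ∩ f ⁻¹' {z}) := by
      refine LipschitzWith.lipschitzOnWith (LipschitzWith.of_dist_le_mul fun x y => ?_)
      rw [dist_eq_norm, dist_eq_norm, ← map_sub, NNReal.coe_one, one_mul]
      exact norm_adjoint_linearIsometry_le i _
    simpa using euclideanHausdorffMeasure_image_le_of_lipschitzOnWith hl (n - r)
  · rw [← EuclideanSpace.euclideanHausdorffMeasure_eq_volume]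
    refine (euclideanHausdorffMeasure_le_of_antilipschitz (f := P) (K := K)
      (fun x hx y hy => ?_) (n - r)).trans ?_
    · have := hanti x hx.1 y hy.1 (hx.2.trans hy.2.symm)
      rw [edist_eq_enorm_sub, edist_eq_enorm_sub]
      simp only [enorm_eq_nnnorm]
      exact_mod_cast this
    · gcongr
      exact_mod_cast hKc
  · rw [hint, hdd, ← mul_assoc]
    exact_mod_cast hδup S _ happrox
  · rw [hint, hdd]
    have := hδlow S _ happrox
    have hc0 : (c : ℝ≥0∞) ≠ 0 := by exact_mod_cast (zero_lt_one.trans hc).ne'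
    calc (d : ℝ≥0∞) * volume S = c * (((c⁻¹ * d : ℝ≥0) : ℝ≥0∞) * volume S) := by
          rw [ENNReal.coe_mul, ENNReal.coe_inv (zero_lt_one.trans hc).ne', ← mul_assoc,
            ← mul_assoc, ENNReal.mul_inv_cancel hc0 ENNReal.coe_ne_top, one_mul]
      _ ≤ _ := by gcongr

end CoareaPiece

/-! ### The coarea formula on the regular set -/

section Coarea

open Filter Topology Module ReactionCoordinate

variable {n r : ℕ}

/-- The points of differentiability at which the derivative is surjective. -/
def regularSet (f : EuclideanSpace ℝ (Fin n) → EuclideanSpace ℝ (Fin r)) :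
    Set (EuclideanSpace ℝ (Fin n)) :=
  {x | DifferentiableAt ℝ f x ∧ Function.Surjective (fderiv ℝ f x)}

lemma measurable_det_fderiv_comp_adjoint
    (f : EuclideanSpace ℝ (Fin n) → EuclideanSpace ℝ (Fin r)) :
    Measurable fun x => (fderiv ℝ f x ∘L ContinuousLinearMap.adjoint (fderiv ℝ f x)).det := by
  have h : Continuous fun A : EuclideanSpace ℝ (Fin n) →L[ℝ] EuclideanSpace ℝ (Fin r) =>
      (A ∘L ContinuousLinearMap.adjoint A).det :=
    ContinuousLinearMap.continuous_det.comp
      (continuous_id.clm_comp ContinuousLinearMap.adjoint.continuous)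
  exact h.measurable.comp (measurable_fderiv ℝ f)

lemma measurable_coareaWeight (f : EuclideanSpace ℝ (Fin n) → EuclideanSpace ℝ (Fin r)) :
    Measurable (coareaWeight f) :=
  (measurable_det_fderiv_comp_adjoint f).sqrt.inv

lemma measurableSet_regularSet (f : EuclideanSpace ℝ (Fin n) → EuclideanSpace ℝ (Fin r)) :
    MeasurableSet (regularSet f) := by
  simp only [regularSet, ← det_comp_adjoint_ne_zero_iff]
  exact (measurableSet_of_differentiableAt ℝ f).inter
    (measurable_det_fderiv_comp_adjoint f (measurableSet_singleton 0).compl)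

lemma continuousOn_regularSet (f : EuclideanSpace ℝ (Fin n) → EuclideanSpace ℝ (Fin r)) :
    ContinuousOn f (regularSet f) :=
  fun _ hx => hx.1.continuousAt.continuousWithinAt

lemma measurableSet_inter_fiber {f : EuclideanSpace ℝ (Fin n) → EuclideanSpace ℝ (Fin r)}
    {E : Set (EuclideanSpace ℝ (Fin n))} (hE : MeasurableSet E) (hEf : E ⊆ regularSet f)
    {B : Set (EuclideanSpace ℝ (Fin r))} (hB : MeasurableSet B) :
    MeasurableSet (E ∩ f ⁻¹' B) := by
  have h := (continuousOn_iff_continuous_domRestrict.1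
    ((continuousOn_regularSet f).mono hEf)).measurable hB
  have h1 := hE.subtype_image h
  rwa [Set.domRestrict_eq, Set.preimage_comp, Subtype.image_preimage_coe] at h1

lemma coareaWeight_pos (hr : r ≤ n) {f : EuclideanSpace ℝ (Fin n) → EuclideanSpace ℝ (Fin r)}
    {x : EuclideanSpace ℝ (Fin n)} (hx : x ∈ regularSet f) : 0 < coareaWeight f x :=
  inv_pos.2 (Real.sqrt_pos.2 (det_comp_adjoint_pos hr _ hx.2))

/-- At a point of non-differentiability `fderiv` is `0` by default, which is surjective only if `r =
0`; but then the target is a point and the map is differentiable after all. -/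
lemma coareaWeight_eq_zero {f : EuclideanSpace ℝ (Fin n) → EuclideanSpace ℝ (Fin r)}
    {x : EuclideanSpace ℝ (Fin n)} (hx : x ∉ regularSet f) : coareaWeight f x = 0 := by
  suffices h : (fderiv ℝ f x ∘L ContinuousLinearMap.adjoint (fderiv ℝ f x)).det = 0 by
    rw [coareaWeight, h, Real.sqrt_zero, inv_zero]
  by_contra h
  rw [← ne_eq, det_comp_adjoint_ne_zero_iff] at h
  refine hx ⟨?_, h⟩
  by_contra hd
  rw [fderiv_zero_of_not_differentiableAt hd] at h
  have : Subsingleton (EuclideanSpace ℝ (Fin r)) := by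
    refine ⟨fun a b => ?_⟩
    obtain ⟨a', rfl⟩ := h a
    obtain ⟨b', rfl⟩ := h b
    simp
  exact hd ((differentiableAt_const (0 : EuclideanSpace ℝ (Fin r))).congr_of_eventuallyEq
    (Eventually.of_forall fun y => Subsingleton.elim _ _))

/-- The weighted Hausdorff measure on the regular part of a fiber. -/
noncomputable def fiberMeasure (f : EuclideanSpace ℝ (Fin n) → EuclideanSpace ℝ (Fin r))
    (z : EuclideanSpace ℝ (Fin r)) : Measure (EuclideanSpace ℝ (Fin n)) :=
  (μHE[n - r].restrict (regularSet f ∩ f ⁻¹' {z})).withDensity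
    fun x => ENNReal.ofReal (coareaWeight f x)

lemma fiberMeasure_apply (f : EuclideanSpace ℝ (Fin n) → EuclideanSpace ℝ (Fin r))
    (z : EuclideanSpace ℝ (Fin r)) {E : Set (EuclideanSpace ℝ (Fin n))} (hE : MeasurableSet E) :
    fiberMeasure f z E =
      ∫⁻ x in E ∩ regularSet f ∩ f ⁻¹' {z}, ENNReal.ofReal (coareaWeight f x) ∂μHE[n - r] := by
  rw [fiberMeasure, withDensity_apply _ hE, Measure.restrict_restrict hE, Set.inter_assoc]

/-- `g` is an approximation, up to powers of `c`, of the function that gives the weighted measure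
of the slices of `E`, and so is its integral of the volume of `E`. -/
structure IsSliceApprox (f : EuclideanSpace ℝ (Fin n) → EuclideanSpace ℝ (Fin r))
    (E : Set (EuclideanSpace ℝ (Fin n))) (c : ℝ≥0) (g : EuclideanSpace ℝ (Fin r) → ℝ≥0∞) :
    Prop where
  measurable : Measurable g
  le_fiber : ∀ z, g z ≤ c * fiberMeasure f z E
  fiber_le : ∀ z, fiberMeasure f z E ≤ c ^ 2 * g z
  lintegral_le : ∫⁻ z, g z ≤ c * volume E
  volume_le : volume E ≤ c * ∫⁻ z, g z

lemma isSliceApprox_tsum {ι : Type*} [Countable ι]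
    {f : EuclideanSpace ℝ (Fin n) → EuclideanSpace ℝ (Fin r)}
    {E : ι → Set (EuclideanSpace ℝ (Fin n))} (hE : ∀ k, MeasurableSet (E k))
    (hdisj : Pairwise (Function.onFun Disjoint E)) {c : ℝ≥0}
    {g : ι → EuclideanSpace ℝ (Fin r) → ℝ≥0∞} (hg : ∀ k, IsSliceApprox f (E k) c (g k)) :
    IsSliceApprox f (⋃ k, E k) c (fun z => ∑' k, g k z) where
  measurable := Measurable.tsum fun k => (hg k).measurable
  le_fiber z := by
    rw [measure_iUnion hdisj hE, ← ENNReal.tsum_mul_left]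
    exact ENNReal.tsum_le_tsum fun k => (hg k).le_fiber z
  fiber_le z := by
    rw [measure_iUnion hdisj hE, ← ENNReal.tsum_mul_left]
    exact ENNReal.tsum_le_tsum fun k => (hg k).fiber_le z
  lintegral_le := by
    rw [lintegral_tsum fun k => (hg k).measurable.aemeasurable, measure_iUnion hdisj hE,
      ← ENNReal.tsum_mul_left]
    exact ENNReal.tsum_le_tsum fun k => (hg k).lintegral_le
  volume_le := by
    rw [lintegral_tsum fun k => (hg k).measurable.aemeasurable, measure_iUnion hdisj hE,
      ← ENNReal.tsum_mul_left]
    exact ENNReal.tsum_le_tsum fun k => (hg k).volume_le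

/-- The weight is replaced by the constant `1 / √det(A A*)`, which cancels the Jacobian. In
`fiber_le` one factor `c` pays for this replacement and the other for the projection of the slice.
-/
lemma exists_isSliceApprox_of_approximatesLinearOn (hr : r ≤ n)
    (A : EuclideanSpace ℝ (Fin n) →L[ℝ] EuclideanSpace ℝ (Fin r)) (hA : Function.Surjective A)
    {c : ℝ≥0} (hc : 1 < c) :
    ∃ δ : ℝ≥0, δ ≠ 0 ∧ ∀ (f : EuclideanSpace ℝ (Fin n) → EuclideanSpace ℝ (Fin r))
      (S : Set (EuclideanSpace ℝ (Fin n))), MeasurableSet S → ApproximatesLinearOn f A S δ →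
      S ⊆ regularSet f →
      (∀ x ∈ S, coareaWeight f x ≤ c * (√(A ∘L ContinuousLinearMap.adjoint A).det)⁻¹) →
      (∀ x ∈ S, (√(A ∘L ContinuousLinearMap.adjoint A).det)⁻¹ ≤ c * coareaWeight f x) →
      ∃ g, IsSliceApprox f S c g := by
  obtain ⟨δ, hδ, H⟩ := exists_slice_volume_of_approximatesLinearOn hr A hA hc
  refine ⟨δ, hδ, fun f S hS hf hSf hw1 hw2 => ?_⟩
  obtain ⟨g, hg, hle, hge, hint, hvol⟩ := H f S hS hf
  set d := √(A ∘L ContinuousLinearMap.adjoint A).det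
  have hd : 0 < d := Real.sqrt_pos.2 (det_comp_adjoint_pos hr A hA)
  set a := ENNReal.ofReal d⁻¹ with ha
  have had : a * ENNReal.ofReal d = 1 := by
    rw [ha, ← ENNReal.ofReal_mul (inv_nonneg.2 hd.le), inv_mul_cancel₀ hd.ne', ENNReal.ofReal_one]
  have hfib : ∀ z, fiberMeasure f z S =
      ∫⁻ x in S ∩ f ⁻¹' {z}, ENNReal.ofReal (coareaWeight f x) ∂μHE[n - r] := fun z => by
    rw [fiberMeasure_apply f z hS, Set.inter_eq_left.2 hSf]
  have hms : ∀ z, MeasurableSet (S ∩ f ⁻¹' {z}) := fun z =>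
    measurableSet_inter_fiber hS hSf (measurableSet_singleton z)
  refine ⟨fun z => a * g z, hg.const_mul a, fun z => ?_, fun z => ?_, ?_, ?_⟩
  · rw [hfib]
    calc a * g z ≤ a * μHE[n - r] (S ∩ f ⁻¹' {z}) := by gcongr; exact hle z
      _ = ∫⁻ _ in S ∩ f ⁻¹' {z}, a ∂μHE[n - r] := (setLIntegral_const _ _).symm
      _ ≤ ∫⁻ x in S ∩ f ⁻¹' {z}, c * ENNReal.ofReal (coareaWeight f x) ∂μHE[n - r] := by
          refine setLIntegral_mono' (hms z) fun x hx => ?_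
          rw [ha, ← ENNReal.ofReal_coe_nnreal, ← ENNReal.ofReal_mul c.coe_nonneg]
          exact ENNReal.ofReal_le_ofReal (hw2 x hx.1)
      _ = _ := lintegral_const_mul _ (measurable_coareaWeight f).ennreal_ofReal
  · rw [hfib]
    calc ∫⁻ x in S ∩ f ⁻¹' {z}, ENNReal.ofReal (coareaWeight f x) ∂μHE[n - r]
        ≤ ∫⁻ _ in S ∩ f ⁻¹' {z}, c * a ∂μHE[n - r] := by
          refine setLIntegral_mono' (hms z) fun x hx => ?_
          rw [ha, ← ENNReal.ofReal_coe_nnreal, ← ENNReal.ofReal_mul c.coe_nonneg]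
          exact ENNReal.ofReal_le_ofReal (hw1 x hx.1)
      _ = c * a * μHE[n - r] (S ∩ f ⁻¹' {z}) := setLIntegral_const _ _
      _ ≤ c * a * (c * g z) := by gcongr; exact hge z
      _ = _ := by ring
  · rw [lintegral_const_mul _ hg]
    calc a * ∫⁻ z, g z ≤ a * (c * (ENNReal.ofReal d * volume S)) := by gcongr
      _ = (a * ENNReal.ofReal d) * (c * volume S) := by ring
      _ = _ := by rw [had, one_mul]
  · rw [lintegral_const_mul _ hg]
    calc volume S = a * (ENNReal.ofReal d * volume S) := by rw [← mul_assoc, had, one_mul]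
      _ ≤ a * (c * ∫⁻ z, g z) := by gcongr
      _ = _ := by ring

lemma exists_isSliceApprox_of_coareaWeight_le (hr : r ≤ n)
    {f : EuclideanSpace ℝ (Fin n) → EuclideanSpace ℝ (Fin r)}
    {E : Set (EuclideanSpace ℝ (Fin n))} (hE : MeasurableSet E) (hEf : E ⊆ regularSet f)
    {c : ℝ≥0} (hc : 1 < c) (hw : ∀ x ∈ E, ∀ y ∈ E, coareaWeight f x ≤ c * coareaWeight f y) :
    ∃ g, IsSliceApprox f E c g := by
  rcases E.eq_empty_or_nonempty with rfl | hne
  · exact ⟨0, measurable_zero, by simp, by simp, by simp, by simp⟩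
  choose δ hδ H using fun A : EuclideanSpace ℝ (Fin n) →L[ℝ] EuclideanSpace ℝ (Fin r) =>
    fun hA : Function.Surjective A => exists_isSliceApprox_of_approximatesLinearOn hr A hA hc
  classical
  obtain ⟨t, A, hdisj, htm, hcover, happrox, hA⟩ :=
    exists_partition_approximatesLinearOn_of_hasFDerivWithinAt f E (fderiv ℝ f)
      (fun x hx => (hEf hx).1.hasFDerivAt.hasFDerivWithinAt)
      -- The radius `1` at non-surjective maps is a dummy: every `A k` of the partition is the
      -- derivative at a point of `E`.
      (fun A => if hA : Function.Surjective A then δ A hA else 1)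
      (fun A => by split_ifs with h; exacts [hδ A h, one_ne_zero])
  have hpiece : ∀ k, ∃ g, IsSliceApprox f (E ∩ t k) c g := by
    intro k
    obtain ⟨y, hy, hAy⟩ := hA hne k
    have hsurj : Function.Surjective (A k) := hAy ▸ (hEf hy).2
    have h := happrox k
    rw [dif_pos hsurj] at h
    refine H (A k) hsurj f _ (hE.inter (htm k)) h (Set.inter_subset_left.trans hEf) ?_ ?_
    · intro x hx
      rw [hAy]
      exact hw x hx.1 y hy
    · intro x hx
      rw [hAy]
      exact hw y hy x hx.1
  choose g hg using hpiece
  have := isSliceApprox_tsum (fun k => hE.inter (htm k))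
    (fun i j hij => (hdisj hij).mono Set.inter_subset_right Set.inter_subset_right) hg
  rw [← Set.inter_iUnion, Set.inter_eq_left.2 hcover] at this
  exact ⟨_, this⟩

/-- Cutting `E` at the powers of `c` of the weight makes the weight vary by a factor of at most `c`
on each piece. -/
lemma exists_isSliceApprox (hr : r ≤ n)
    {f : EuclideanSpace ℝ (Fin n) → EuclideanSpace ℝ (Fin r)}
    {E : Set (EuclideanSpace ℝ (Fin n))} (hE : MeasurableSet E) (hEf : E ⊆ regularSet f)
    {c : ℝ≥0} (hc : 1 < c) : ∃ g, IsSliceApprox f E c g := by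
  have hlog : 0 < Real.log c := Real.log_pos (by exact_mod_cast hc)
  set l : EuclideanSpace ℝ (Fin n) → ℤ := fun x => ⌊Real.log (coareaWeight f x) / Real.log c⌋
  have hl : Measurable l :=
    Int.measurable_floor.comp ((measurable_coareaWeight f).log.div_const _)
  have hm : ∀ k, MeasurableSet (E ∩ l ⁻¹' {k}) := fun k => hE.inter (hl (measurableSet_singleton k))
  have hpiece : ∀ k : ℤ, ∃ g, IsSliceApprox f (E ∩ l ⁻¹' {k}) c g := by
    intro k
    refine exists_isSliceApprox_of_coareaWeight_le hr (hm k)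
      (Set.inter_subset_left.trans hEf) hc fun x hx y hy => ?_
    have hx1 := coareaWeight_pos hr (hEf hx.1)
    have hy1 := coareaWeight_pos hr (hEf hy.1)
    have h1 := (Int.floor_eq_iff.1 (show l x = k from hx.2)).2
    have h2 := (Int.floor_eq_iff.1 (show l y = k from hy.2)).1
    rw [div_lt_iff₀ hlog] at h1
    rw [le_div_iff₀ hlog] at h2
    have hc0 : (0 : ℝ) < c := by exact_mod_cast zero_lt_one.trans hc
    rw [← Real.log_le_log_iff hx1 (mul_pos hc0 hy1), Real.log_mul hc0.ne' hy1.ne']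
    linarith
  choose g hg using hpiece
  have := isSliceApprox_tsum hm (fun i j hij => by
    refine Disjoint.mono Set.inter_subset_right Set.inter_subset_right ?_
    exact Disjoint.preimage _ (by simpa using hij)) hg
  rw [← Set.inter_iUnion, ← Set.preimage_iUnion, Set.iUnion_of_singleton, Set.preimage_univ,
    Set.inter_univ] at this
  exact ⟨_, this⟩

lemma exists_seq_one_lt_tendsto_one :
    ∃ u : ℕ → ℝ≥0, (∀ m, 1 < u m) ∧ Tendsto u atTop (𝓝 1) := by
  obtain ⟨u, -, h1, h2⟩ := exists_seq_strictAnti_tendsto (1 : ℝ≥0)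
  exact ⟨u, h1, h2⟩

lemma ENNReal.le_of_forall_le_pow_mul {u : ℕ → ℝ≥0} (hu : Tendsto u atTop (𝓝 1)) (k : ℕ)
    {a b : ℝ≥0∞} (h : ∀ m, a ≤ (u m : ℝ≥0∞) ^ k * b) : a ≤ b := by
  have h1 : Tendsto (fun m => (u m : ℝ≥0∞) ^ k * b) atTop (𝓝 b) := by
    have h2 : Tendsto (fun m => ((u m ^ k : ℝ≥0) : ℝ≥0∞)) atTop (𝓝 1) :=
      ENNReal.tendsto_coe.2 (by simpa using hu.pow k)
    simpa using ENNReal.Tendsto.mul_const h2 (Or.inl one_ne_zero) (b := b)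
  exact ge_of_tendsto' h1 h

/-- The coarea formula for sets of regular points. -/
theorem measurable_fiberMeasure_and_lintegral_eq_volume (hr : r ≤ n)
    {f : EuclideanSpace ℝ (Fin n) → EuclideanSpace ℝ (Fin r)}
    {E : Set (EuclideanSpace ℝ (Fin n))} (hE : MeasurableSet E) (hEf : E ⊆ regularSet f) :
    Measurable (fun z => fiberMeasure f z E) ∧ ∫⁻ z, fiberMeasure f z E = volume E := by
  obtain ⟨u, hu1, hu⟩ := exists_seq_one_lt_tendsto_one
  choose g hg using fun m => exists_isSliceApprox hr hE hEf (hu1 m)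
  have hne : ∀ m, (u m : ℝ≥0∞) ≠ 0 := fun m => by
    exact_mod_cast (zero_lt_one.trans (hu1 m)).ne'
  -- The two-sided bounds with `u m → 1` exhibit the fiber measure as a supremum of measurable
  -- functions. The exponent `3` below is the `2` of `fiber_le` plus one for the factor `(u m)⁻¹`.
  have hsup : (fun z => fiberMeasure f z E) = fun z => ⨆ m, (u m : ℝ≥0∞)⁻¹ * g m z := by
    ext z
    refine le_antisymm (ENNReal.le_of_forall_le_pow_mul hu 3 fun m => ?_) (iSup_le fun m => ?_)
    · calc fiberMeasure f z E ≤ (u m : ℝ≥0∞) ^ 2 * g m z := (hg m).fiber_le z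
        _ = (u m : ℝ≥0∞) ^ 3 * ((u m : ℝ≥0∞)⁻¹ * g m z) := by
            rw [pow_succ (u m : ℝ≥0∞) 2, mul_assoc, ← mul_assoc (u m : ℝ≥0∞) _ (g m z),
              ENNReal.mul_inv_cancel (hne m) ENNReal.coe_ne_top, one_mul]
        _ ≤ _ := by gcongr; exact le_iSup (fun m => (u m : ℝ≥0∞)⁻¹ * g m z) m
    · rw [mul_comm, ← div_eq_mul_inv]
      exact ENNReal.div_le_of_le_mul' ((hg m).le_fiber z)
  refine ⟨?_, le_antisymm ?_ ?_⟩
  · rw [hsup]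
    exact Measurable.iSup fun m => (hg m).measurable.const_mul _
  · refine ENNReal.le_of_forall_le_pow_mul hu 3 fun m => ?_
    calc ∫⁻ z, fiberMeasure f z E ≤ ∫⁻ z, (u m : ℝ≥0∞) ^ 2 * g m z :=
          lintegral_mono (hg m).fiber_le
      _ = (u m : ℝ≥0∞) ^ 2 * ∫⁻ z, g m z := lintegral_const_mul _ (hg m).measurable
      _ ≤ (u m : ℝ≥0∞) ^ 2 * (u m * volume E) := by gcongr; exact (hg m).lintegral_le
      _ = _ := by ring
  · refine ENNReal.le_of_forall_le_pow_mul hu 2 fun m => ?_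
    calc volume E ≤ u m * ∫⁻ z, g m z := (hg m).volume_le
      _ ≤ u m * ∫⁻ z, u m * fiberMeasure f z E := by
          gcongr with z; exact (hg m).le_fiber z
      _ = u m * (u m * ∫⁻ z, fiberMeasure f z E) := by
          rw [lintegral_const_mul' _ _ ENNReal.coe_ne_top]
      _ = _ := by ring

lemma fiberMeasure_eq_fiberMeasure_inter
    (f : EuclideanSpace ℝ (Fin n) → EuclideanSpace ℝ (Fin r)) (z : EuclideanSpace ℝ (Fin r))
    {E : Set (EuclideanSpace ℝ (Fin n))} (hE : MeasurableSet E) :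
    fiberMeasure f z E = fiberMeasure f z (E ∩ regularSet f) := by
  rw [fiberMeasure_apply f z hE, fiberMeasure_apply f z (hE.inter (measurableSet_regularSet f)),
    Set.inter_assoc E (regularSet f) (regularSet f), Set.inter_self]

lemma measurable_fiberMeasure (hr : r ≤ n)
    (f : EuclideanSpace ℝ (Fin n) → EuclideanSpace ℝ (Fin r)) : Measurable (fiberMeasure f) := by
  refine Measure.measurable_of_measurable_coe _ fun E hE => ?_
  simp only [fiberMeasure_eq_fiberMeasure_inter f _ hE]
  exact (measurable_fiberMeasure_and_lintegral_eq_volume hr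
    (hE.inter (measurableSet_regularSet f)) Set.inter_subset_right).1

lemma bind_fiberMeasure (hr : r ≤ n)
    (f : EuclideanSpace ℝ (Fin n) → EuclideanSpace ℝ (Fin r)) :
    (volume : Measure (EuclideanSpace ℝ (Fin r))).bind (fiberMeasure f) =
      volume.restrict (regularSet f) := by
  ext E hE
  rw [Measure.bind_apply hE (measurable_fiberMeasure hr f).aemeasurable,
    Measure.restrict_apply hE]
  simp only [fiberMeasure_eq_fiberMeasure_inter f _ hE]
  exact (measurable_fiberMeasure_and_lintegral_eq_volume hr
    (hE.inter (measurableSet_regularSet f)) Set.inter_subset_right).2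

/-- The coarea formula for functions. -/
theorem lintegral_fiberMeasure (hr : r ≤ n)
    (f : EuclideanSpace ℝ (Fin n) → EuclideanSpace ℝ (Fin r))
    {g : EuclideanSpace ℝ (Fin n) → ℝ≥0∞} (hg : Measurable g) :
    ∫⁻ z, ∫⁻ x, g x ∂(fiberMeasure f z) = ∫⁻ x in regularSet f, g x := by
  rw [← bind_fiberMeasure hr f,
    Measure.lintegral_bind (measurable_fiberMeasure hr f).aemeasurable hg.aemeasurable]

end Coarea

/-! ### Image measures and non-measurable functions -/

section Pushforward

open Filter Topology

variable {E F : Type*} [TopologicalSpace E] [T2Space E] [MeasurableSpace E] [BorelSpace E]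
  [TopologicalSpace F] [T2Space F] [MeasurableSpace F] [BorelSpace F]
  {μ : Measure E} [IsFiniteMeasure μ] [μ.InnerRegularCompactLTTop] {φ : E → F} {X : Set E}

/-- A continuous image of a Borel set need not be Borel, but that of a countable union of compact
sets is; inner regularity provides such a union of full measure in `A`. -/
lemma exists_subset_measurableSet_image (hφ : ContinuousOn φ X)
    {A : Set E} (hA : MeasurableSet A) (hAX : A ⊆ X) :
    ∃ U ⊆ A, MeasurableSet U ∧ μ (A \ U) = 0 ∧ MeasurableSet (φ '' U) := by
  have hK : ∀ k : ℕ, ∃ K ⊆ A, IsCompact K ∧ μ A < μ K + ((k : ℝ≥0∞) + 1)⁻¹ := fun k =>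
    hA.exists_isCompact_lt_add (measure_ne_top μ A) (by simp)
  choose K hKA hKc hKμ using hK
  have hU : MeasurableSet (⋃ k, K k) := MeasurableSet.iUnion fun k => (hKc k).measurableSet
  refine ⟨⋃ k, K k, Set.iUnion_subset hKA, hU, ?_, ?_⟩
  · rw [measure_sdiff (Set.iUnion_subset hKA) hU.nullMeasurableSet (measure_ne_top _ _),
      tsub_eq_zero_iff_le]
    have hlim : Tendsto (fun k : ℕ => μ (⋃ k, K k) + ((k : ℝ≥0∞) + 1)⁻¹) atTop
        (𝓝 (μ (⋃ k, K k) + 0)) := by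
      refine tendsto_const_nhds.add ?_
      have := (tendsto_add_atTop_iff_nat 1).2 ENNReal.tendsto_inv_nat_nhds_zero
      simpa using this
    rw [add_zero] at hlim
    exact ge_of_tendsto' hlim fun k => (hKμ k).le.trans
      (by gcongr; exact Set.subset_iUnion K k)
  · rw [Set.image_iUnion]
    exact MeasurableSet.iUnion fun k =>
      ((hKc k).image_of_continuousOn (hφ.mono ((hKA k).trans hAX))).measurableSet

/-- The preimages of `s` and `sᶜ` are exhausted by sets with Borel images, one inside `s` and one
inside `sᶜ`. Together these images carry the whole image measure, so `s` differs from the first by a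
null set. -/
lemma MeasureTheory.NullMeasurableSet.of_preimage_of_continuousOn (hX : MeasurableSet X) (hμX : μ Xᶜ = 0)
    (hφ : ContinuousOn φ X) (hφm : AEMeasurable φ μ) {s : Set F}
    (hs : NullMeasurableSet (φ ⁻¹' s) μ) : NullMeasurableSet s (μ.map φ) := by
  obtain ⟨A, hAs, hA, hAeq⟩ := hs.exists_measurable_subset_ae_eq
  obtain ⟨B, hBs, hB, hBeq⟩ := hs.compl.exists_measurable_subset_ae_eq
  obtain ⟨U, hUA, hU, hUμ, hUφ⟩ := exists_subset_measurableSet_image (μ := μ) hφ (hA.inter hX)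
    Set.inter_subset_right
  obtain ⟨V, hVB, hV, hVμ, hVφ⟩ := exists_subset_measurableSet_image (μ := μ) hφ (hB.inter hX)
    Set.inter_subset_right
  have hUs : φ '' U ⊆ s := by
    rintro _ ⟨x, hx, rfl⟩
    exact hAs (hUA hx).1
  have hVs : φ '' V ⊆ sᶜ := by
    rintro _ ⟨x, hx, rfl⟩
    exact hBs (hVB hx).1
  have hnull : μ.map φ (s \ φ '' U) = 0 := by
    refine measure_mono_null (t := (φ '' V)ᶜ \ φ '' U)
      (Set.sdiff_subset_sdiff_left fun y hy hyV => hVs hyV hy) ?_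
    rw [Measure.map_apply_of_aemeasurable hφm (hVφ.compl.diff hUφ)]
    have hae : ∀ᵐ x ∂μ, x ∈ U ∨ x ∈ V := by
      have h1 : ∀ᵐ x ∂μ, x ∈ X := hμX
      have h2 : ∀ᵐ x ∂μ, x ∉ (A ∩ X) \ U := measure_eq_zero_iff_ae_notMem.1 hUμ
      have h3 : ∀ᵐ x ∂μ, x ∉ (B ∩ X) \ V := measure_eq_zero_iff_ae_notMem.1 hVμ
      filter_upwards [h1, h2, h3, hAeq.mem_iff, hBeq.mem_iff] with x h1 h2 h3 h4 h5
      by_cases hx : x ∈ φ ⁻¹' s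
      · left
        by_contra hxU
        exact h2 ⟨⟨h4.2 hx, h1⟩, hxU⟩
      · right
        by_contra hxV
        exact h3 ⟨⟨h5.2 hx, h1⟩, hxV⟩
    rw [measure_eq_zero_iff_ae_notMem]
    filter_upwards [hae] with x hx hx'
    rcases hx with hx | hx
    · exact hx'.2 ⟨x, hx, rfl⟩
    · exact hx'.1 ⟨x, hx, rfl⟩
  rw [← Set.union_sdiff_cancel hUs]
  exact hUφ.nullMeasurableSet.union (NullMeasurableSet.of_null hnull)

lemma aemeasurable_map_iff_of_continuousOn (hX : MeasurableSet X) (hμX : μ Xᶜ = 0)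
    (hφ : ContinuousOn φ X) (hφm : AEMeasurable φ μ) {f : F → ℝ} :
    AEMeasurable f (μ.map φ) ↔ AEMeasurable (fun x => f (φ x)) μ := by
  refine ⟨fun h => h.comp_aemeasurable hφm, fun h => ?_⟩
  refine NullMeasurable.aemeasurable fun s hs => ?_
  exact NullMeasurableSet.of_preimage_of_continuousOn hX hμX hφ hφm (h.nullMeasurable hs)

/-- The minorant `g` is rebuilt from the rational superlevel sets of `h`, each shrunk by a null set
so that its image is Borel. On the image of `{h > q}`, `f` is greater than `q`. -/
lemma exists_measurable_le_of_le_comp (hX : MeasurableSet X) (hμX : μ Xᶜ = 0)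
    (hφ : ContinuousOn φ X) {f : F → ℝ≥0∞} {h : E → ℝ≥0∞} (hh : Measurable h)
    (hle : ∀ x, h x ≤ f (φ x)) :
    ∃ g : F → ℝ≥0∞, Measurable g ∧ g ≤ f ∧ ∀ᵐ x ∂μ, h x ≤ g (φ x) := by
  have hA : ∀ q : ℚ, MeasurableSet (h ⁻¹' Set.Ioi (ENNReal.ofReal q) ∩ X) := fun q =>
    (hh measurableSet_Ioi).inter hX
  choose U hUA hU hUμ hUφ using fun q : ℚ =>
    exists_subset_measurableSet_image (μ := μ) hφ (hA q) Set.inter_subset_right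
  refine ⟨fun y => ⨆ q : ℚ, (φ '' U q).indicator (fun _ => ENNReal.ofReal q) y,
    Measurable.iSup fun q => measurable_const.indicator (hUφ q), fun y => iSup_le fun q => ?_, ?_⟩
  · refine Set.indicator_apply_le' ?_ (fun _ => zero_le)
    rintro ⟨x, hx, rfl⟩
    exact (hUA q hx).1.le.trans (hle x)
  · have h1 : ∀ᵐ x ∂μ, x ∈ X := hμX
    have h2 : ∀ᵐ x ∂μ, ∀ q : ℚ, x ∉ (h ⁻¹' Set.Ioi (ENNReal.ofReal q) ∩ X) \ U q :=
      ae_all_iff.2 fun q => measure_eq_zero_iff_ae_notMem.1 (hUμ q)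
    filter_upwards [h1, h2] with x h1 h2
    refine le_of_forall_lt fun a ha => ?_
    obtain ⟨q, hq, haq, hqh⟩ := ENNReal.lt_iff_exists_rat_btwn.1 ha
    have hxU : x ∈ U q := by
      by_contra hxU
      exact h2 q ⟨⟨hqh, h1⟩, hxU⟩
    refine haq.trans_le (le_iSup_of_le q ?_)
    rw [Set.indicator_of_mem (Set.mem_image_of_mem φ hxU)]
    exact le_rfl

/-- The lower integral is attained by a measurable minorant. Minorants of `f` pull back trivially;
those of `f ∘ φ` descend by `exists_measurable_le_of_le_comp`. -/
lemma lintegral_map_of_continuousOn (hX : MeasurableSet X) (hμX : μ Xᶜ = 0)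
    (hφ : ContinuousOn φ X) (hφm : AEMeasurable φ μ) (f : F → ℝ≥0∞) :
    ∫⁻ y, f y ∂(μ.map φ) = ∫⁻ x, f (φ x) ∂μ := by
  refine le_antisymm ?_ ?_
  · obtain ⟨g, hg, hgf, hint⟩ := exists_measurable_le_lintegral_eq (μ.map φ) f
    rw [hint, lintegral_map' hg.aemeasurable hφm]
    exact lintegral_mono fun x => hgf _
  · obtain ⟨h, hh, hhf, hint⟩ := exists_measurable_le_lintegral_eq μ (fun x => f (φ x))
    obtain ⟨g, hg, hgf, hae⟩ := exists_measurable_le_of_le_comp (μ := μ) hX hμX hφ hh hhf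
    rw [hint]
    calc ∫⁻ x, h x ∂μ ≤ ∫⁻ x, g (φ x) ∂μ := lintegral_mono_ae hae
      _ = ∫⁻ y, g y ∂(μ.map φ) := (lintegral_map' hg.aemeasurable hφm).symm
      _ ≤ _ := lintegral_mono hgf

lemma memLp_map_iff_of_continuousOn (hX : MeasurableSet X) (hμX : μ Xᶜ = 0)
    (hφ : ContinuousOn φ X) (hφm : AEMeasurable φ μ) (f : F → ℝ) (p : ℝ≥0∞) :
    MemLp (fun x => f (φ x)) p μ ↔ MemLp f p (μ.map φ) := by
  have h := aemeasurable_map_iff_of_continuousOn hX hμX hφ hφm (f := f)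
  by_cases hf : AEMeasurable f (μ.map φ)
  · exact (memLp_map_measure_iff hf.aestronglyMeasurable hφm).symm
  · exact iff_of_false (fun h1 => hf (h.2 h1.1.aemeasurable)) (fun h1 => hf h1.1.aemeasurable)

/-- The means agree even without measurability, as both then have the default value `0`; the rest is
an equality of lower integrals. -/
lemma variance_map_of_continuousOn (hX : MeasurableSet X) (hμX : μ Xᶜ = 0)
    (hφ : ContinuousOn φ X) (hφm : AEMeasurable φ μ) (f : F → ℝ) :
    ProbabilityTheory.variance (fun x => f (φ x)) μ =
      ProbabilityTheory.variance f (μ.map φ) := by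
  have h := aemeasurable_map_iff_of_continuousOn hX hμX hφ hφm (f := f)
  have hint : ∫ x, f (φ x) ∂μ = ∫ y, f y ∂(μ.map φ) := by
    by_cases hf : AEMeasurable f (μ.map φ)
    · exact (integral_map hφm hf.aestronglyMeasurable).symm
    · rw [integral_non_aestronglyMeasurable fun h1 => hf h1.aemeasurable,
        integral_non_aestronglyMeasurable fun h1 => hf (h.2 h1.aemeasurable)]
  rw [ProbabilityTheory.variance, ProbabilityTheory.variance, ProbabilityTheory.evariance,
    ProbabilityTheory.evariance, hint,
    lintegral_map_of_continuousOn hX hμX hφ hφm fun y => ‖f y - ∫ y, f y ∂(μ.map φ)‖ₑ ^ 2]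

end Pushforward

/-! ### The effective measure as an image measure -/

section EffectiveMeasure

open Filter Topology ReactionCoordinate

variable {n r : ℕ}

lemma hausdorff_fiber_eq_zero_of_fiberMeasure_eq_zero (hr : r ≤ n)
    {f : EuclideanSpace ℝ (Fin n) → EuclideanSpace ℝ (Fin r)} {z : EuclideanSpace ℝ (Fin r)}
    {N : Set (EuclideanSpace ℝ (Fin n))} (hN : MeasurableSet N) (h : fiberMeasure f z N = 0) :
    μHE[n - r] (N ∩ regularSet f ∩ f ⁻¹' {z}) = 0 := by
  have hm : MeasurableSet (N ∩ regularSet f ∩ f ⁻¹' {z}) :=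
    measurableSet_inter_fiber (hN.inter (measurableSet_regularSet f)) Set.inter_subset_right
      (measurableSet_singleton z)
  rw [fiberMeasure_apply f z hN,
    lintegral_eq_zero_iff (measurable_coareaWeight f).ennreal_ofReal] at h
  have h1 : ∀ᵐ x ∂(μHE[n - r].restrict (N ∩ regularSet f ∩ f ⁻¹' {z})), False := by
    filter_upwards [h, ae_restrict_mem hm] with x hx hxm
    exact (ENNReal.ofReal_pos.2 (coareaWeight_pos hr hxm.1.2)).ne' hx
  simpa [ae_iff] using h1

/-- For a set `X` that differs from the Borel set `X₀ ⊆ X` by a Lebesgue null set, almost every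
surface measure is the fiber measure on `X₀`. -/
lemma surfaceMeasure_ae_eq (hr : r ≤ n) {X X₀ : Set (EuclideanSpace ℝ (Fin n))}
    (hX₀ : MeasurableSet X₀) (hsub : X₀ ⊆ X) (hnull : volume (X \ X₀) = 0)
    (f : EuclideanSpace ℝ (Fin n) → EuclideanSpace ℝ (Fin r)) :
    ∀ᵐ z, surfaceMeasure X f z = (fiberMeasure f z).restrict X₀ := by
  set N := toMeasurable volume (X \ X₀) with hN
  have hNm : MeasurableSet N := measurableSet_toMeasurable _ _
  have hN0 : volume N = 0 := by rw [hN, measure_toMeasurable, hnull]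
  -- By the coarea formula, a Borel null set containing `X \ X₀` meets the regular part of almost
  -- every fiber in a Hausdorff null set.
  have hint : ∫⁻ z, fiberMeasure f z N = 0 := by
    rw [← Measure.bind_apply hNm (measurable_fiberMeasure hr f).aemeasurable,
      bind_fiberMeasure hr f]
    exact Measure.restrict_apply_eq_zero' (measurableSet_regularSet f) |>.2
      (measure_mono_null Set.inter_subset_left hN0)
  rw [lintegral_eq_zero_iff (Measure.measurable_measure.1 (measurable_fiberMeasure hr f) N hNm)]
    at hint
  filter_upwards [hint] with z hz
  have hz0 := hausdorff_fiber_eq_zero_of_fiberMeasure_eq_zero hr hNm hz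
  have hind : (fun x => ENNReal.ofReal (coareaWeight f x)) =
      (regularSet f).indicator fun x => ENNReal.ofReal (coareaWeight f x) := by
    ext x
    by_cases hx : x ∈ regularSet f
    · rw [Set.indicator_of_mem hx]
    · rw [Set.indicator_of_notMem hx, coareaWeight_eq_zero hx, ENNReal.ofReal_zero]
  rw [surfaceMeasure, hind, withDensity_indicator (measurableSet_regularSet f),
    Measure.restrict_restrict (measurableSet_regularSet f), fiberMeasure,
    restrict_withDensity hX₀, Measure.restrict_restrict hX₀]
  congr 1
  refine Measure.restrict_congr_set ?_
  have hne : ∀ᵐ x ∂(μHE[n - r] : Measure (EuclideanSpace ℝ (Fin n))),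
      x ∉ N ∩ regularSet f ∩ f ⁻¹' {z} := measure_eq_zero_iff_ae_notMem.1 hz0
  filter_upwards [hne] with x hx
  refine propext ⟨fun ⟨h1, h2, h3⟩ => ⟨?_, h1, h3⟩, fun ⟨h1, h2, h3⟩ => ⟨h2, hsub h1, h3⟩⟩
  by_contra h4
  exact hx ⟨⟨subset_toMeasurable _ _ ⟨h2, h4⟩, h1⟩, h3⟩

lemma ae_fiberMeasure_eq {f : EuclideanSpace ℝ (Fin n) → EuclideanSpace ℝ (Fin r)}
    (z : EuclideanSpace ℝ (Fin r)) : ∀ᵐ x ∂(fiberMeasure f z), f x = z := by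
  refine (withDensity_absolutelyContinuous _ _).ae_le ?_
  have hm := measurableSet_inter_fiber (measurableSet_regularSet f) subset_rfl
    (measurableSet_singleton z)
  filter_upwards [ae_restrict_mem hm] with x hx
  exact hx.2

lemma measurable_indicator_of_continuousOn {X₀ : Set (EuclideanSpace ℝ (Fin n))}
    (hX₀ : MeasurableSet X₀) {π : EuclideanSpace ℝ (Fin n) → ℝ} (hπ : ContinuousOn π X₀) :
    Measurable (X₀.indicator fun x => ENNReal.ofReal (π x)) := by
  classical
  have h := (ENNReal.continuous_ofReal.comp_continuousOn hπ).measurable_piecewise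
    (g := fun _ => 0) continuousOn_const hX₀
  rwa [show (fun _ : EuclideanSpace ℝ (Fin n) => (0 : ℝ≥0∞)) = 0 from rfl,
    Set.piecewise_eq_indicator] at h

lemma stationaryMeasure_eq_withDensity_indicator {X X₀ : Set (EuclideanSpace ℝ (Fin n))}
    (hX₀ : MeasurableSet X₀) (heq : X₀ =ᵐ[volume] X) (π : EuclideanSpace ℝ (Fin n) → ℝ) :
    stationaryMeasure X π =
      volume.withDensity (X₀.indicator fun x => ENNReal.ofReal (π x)) := by
  rw [stationaryMeasure, withDensity_indicator hX₀, Measure.restrict_congr_set heq]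

lemma stationaryMeasure_compl {X X₀ : Set (EuclideanSpace ℝ (Fin n))}
    (hX₀ : MeasurableSet X₀) (heq : X₀ =ᵐ[volume] X) (π : EuclideanSpace ℝ (Fin n) → ℝ) :
    stationaryMeasure X π X₀ᶜ = 0 := by
  rw [stationaryMeasure, ← Measure.restrict_congr_set heq]
  refine withDensity_absolutelyContinuous _ _ ?_
  rw [Measure.restrict_apply hX₀.compl, Set.compl_inter_self, measure_empty]

lemma ReactionCoordinate.IsReactionCoordinate.aemeasurable {X X₀ : Set (EuclideanSpace ℝ (Fin n))}
    {Z : Set (EuclideanSpace ℝ (Fin r))} (hX₀ : MeasurableSet X₀) (hsub : X₀ ⊆ X)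
    (heq : X₀ =ᵐ[volume] X) (π : EuclideanSpace ℝ (Fin n) → ℝ)
    {ξ : EuclideanSpace ℝ (Fin n) → EuclideanSpace ℝ (Fin r)}
    (hξ : IsReactionCoordinate X Z ξ) : AEMeasurable ξ (stationaryMeasure X π) := by
  have h := (hξ.continuousOn.mono hsub).aemeasurable (μ := stationaryMeasure X π) hX₀
  rwa [Measure.restrict_eq_self_of_ae_mem
    (show ∀ᵐ x ∂stationaryMeasure X π, x ∈ X₀ from stationaryMeasure_compl hX₀ heq π)] at h

/-- The effective measure is the image of the stationary measure under the reaction coordinate. -/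
lemma map_stationaryMeasure (hr : r ≤ n) {X X₀ : Set (EuclideanSpace ℝ (Fin n))}
    {Z : Set (EuclideanSpace ℝ (Fin r))} (hX₀ : MeasurableSet X₀) (hsub : X₀ ⊆ X)
    (heq : X₀ =ᵐ[volume] X) {π : EuclideanSpace ℝ (Fin n) → ℝ} (hπ : ContinuousOn π X)
    {ξ : EuclideanSpace ℝ (Fin n) → EuclideanSpace ℝ (Fin r)}
    (hξ : IsReactionCoordinate X Z ξ) (hZ : MeasurableSet Z) :
    (stationaryMeasure X π).map ξ = effectiveMeasure X Z π ξ := by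
  set ρ := X₀.indicator fun x => ENNReal.ofReal (π x) with hρdef
  have hρ : Measurable ρ := measurable_indicator_of_continuousOn hX₀ (hπ.mono hsub)
  have hnull : volume (X \ X₀) = 0 := ae_le_set.1 heq.symm.le
  have hdens : ∀ᵐ z, effectiveDensity X π ξ z = ∫⁻ x, ρ x ∂(fiberMeasure ξ z) := by
    filter_upwards [surfaceMeasure_ae_eq hr hX₀ hsub hnull ξ] with z hz
    rw [effectiveDensity, hz, hρdef, lintegral_indicator hX₀]
  -- Fibers over points outside `Z` do not meet `X`, so the integral over `Z` extends to all of
  -- `ℝʳ`.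
  have hdens0 : ∀ z ∉ Z, ∫⁻ x, ρ x ∂(fiberMeasure ξ z) = 0 := by
    intro z hz
    rw [lintegral_eq_zero_iff hρ]
    filter_upwards [ae_fiberMeasure_eq z] with x hx
    refine Set.indicator_of_notMem (fun hxX => hz ?_) _
    exact hx ▸ hξ.mapsTo (hsub hxX)
  have hregular : ∀ᵐ x, x ∈ X₀ → x ∈ regularSet ξ := by
    have h1 := hξ.regular
    rw [← Measure.restrict_congr_set heq, ae_restrict_iff' hX₀] at h1
    exact h1
  ext B hB
  have hBX : MeasurableSet (X₀ ∩ ξ ⁻¹' B) := by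
    have h := (continuousOn_iff_continuous_domRestrict.1
      (hξ.continuousOn.mono hsub)).measurable hB
    have h1 := hX₀.subtype_image h
    rwa [Set.domRestrict_eq, Set.preimage_comp, Subtype.image_preimage_coe] at h1
  have hleft : (stationaryMeasure X π).map ξ B = ∫⁻ x in X₀ ∩ ξ ⁻¹' B, ρ x := by
    rw [Measure.map_apply_of_aemeasurable (hξ.aemeasurable hX₀ hsub heq π) hB,
      ← withDensity_apply _ hBX, ← stationaryMeasure_eq_withDensity_indicator hX₀ heq]
    refine measure_congr ?_
    filter_upwards [show ∀ᵐ x ∂stationaryMeasure X π, x ∈ X₀ from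
      stationaryMeasure_compl hX₀ heq π] with x hx
    exact propext ⟨fun h => ⟨hx, h⟩, fun h => h.2⟩
  have hright : effectiveMeasure X Z π ξ B =
      ∫⁻ z, B.indicator (fun z => ∫⁻ x, ρ x ∂(fiberMeasure ξ z)) z := by
    rw [effectiveMeasure, withDensity_apply _ hB, Measure.restrict_restrict hB,
      lintegral_congr_ae (ae_restrict_of_ae hdens), ← lintegral_indicator (hB.inter hZ)]
    refine lintegral_congr fun z => ?_
    by_cases hzB : z ∈ B
    · by_cases hzZ : z ∈ Z
      · rw [Set.indicator_of_mem (Set.mem_inter hzB hzZ), Set.indicator_of_mem hzB]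
      · rw [Set.indicator_of_notMem fun h => hzZ h.2, Set.indicator_of_mem hzB, hdens0 z hzZ]
    · rw [Set.indicator_of_notMem fun h => hzB h.1, Set.indicator_of_notMem hzB]
  have hfib : ∀ z, ∫⁻ x, (X₀ ∩ ξ ⁻¹' B).indicator ρ x ∂(fiberMeasure ξ z) =
      B.indicator (fun z => ∫⁻ x, ρ x ∂(fiberMeasure ξ z)) z := by
    intro z
    by_cases hz : z ∈ B
    · rw [Set.indicator_of_mem hz]
      refine lintegral_congr_ae ?_
      filter_upwards [ae_fiberMeasure_eq z] with x hx
      by_cases hxX : x ∈ X₀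
      · exact Set.indicator_of_mem (Set.mem_inter hxX (show ξ x ∈ B by rwa [hx])) _
      · rw [Set.indicator_of_notMem fun h => hxX h.1, hρdef, Set.indicator_of_notMem hxX]
    · rw [Set.indicator_of_notMem hz, lintegral_eq_zero_iff (hρ.indicator hBX)]
      filter_upwards [ae_fiberMeasure_eq z] with x hx
      exact Set.indicator_of_notMem (fun h => hz (hx ▸ h.2)) _
  rw [hleft, hright, ← lintegral_indicator hBX]
  simp only [← hfib]
  -- The coarea formula for the density cut off to `ξ ⁻¹' B`. The irregular points that it ignores
  -- form a null set in `X₀`.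
  rw [lintegral_fiberMeasure hr ξ (hρ.indicator hBX),
    ← lintegral_indicator (measurableSet_regularSet ξ)]
  refine lintegral_congr_ae ?_
  filter_upwards [hregular] with x hx
  by_cases hxX : x ∈ X₀
  · rw [Set.indicator_of_mem (hx hxX)]
  · by_cases hxD : x ∈ regularSet ξ
    · rw [Set.indicator_of_mem hxD]
    · rw [Set.indicator_of_notMem hxD, Set.indicator_of_notMem fun h => hxX h.1]

end EffectiveMeasure

theorem mainTheorem8 {n r : ℕ} (hr : r ≤ n)
    (X : Set (EuclideanSpace ℝ (Fin n))) (Z : Set (EuclideanSpace ℝ (Fin r)))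
    (hZ : MeasurableSet Z)
    (π : EuclideanSpace ℝ (Fin n) → ℝ)
    (p : ℝ → EuclideanSpace ℝ (Fin n) → EuclideanSpace ℝ (Fin n) → ℝ)
    (hsys : ReactionCoordinate.IsReversibleSystem X π p)
    (ξ ϑ : EuclideanSpace ℝ (Fin n) → EuclideanSpace ℝ (Fin r))
    (hξ : ReactionCoordinate.IsReactionCoordinate X Z ξ)
    (hϑ : ReactionCoordinate.IsReactionCoordinate X Z ϑ)
    (ε : ℝ≥0) (τ : ℝ)
    (pL : ℝ → EuclideanSpace ℝ (Fin r) → EuclideanSpace ℝ (Fin n) → ℝ)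
    (hL : ReactionCoordinate.IsLumpable X Z π p ξ ε τ pL) :
    IsProbabilityMeasure (ReactionCoordinate.effectiveMeasure X Z π ξ) ∧
    (MemLp (fun x => ReactionCoordinate.effectiveIntegrand X Z π ϑ (pL τ) (ξ x)) 2
        (ReactionCoordinate.stationaryMeasure X π) ↔
      MemLp (ReactionCoordinate.effectiveIntegrand X Z π ϑ (pL τ)) 2
        (ReactionCoordinate.effectiveMeasure X Z π ξ)) ∧
    ProbabilityTheory.variance
        (fun x => ReactionCoordinate.effectiveIntegrand X Z π ϑ (pL τ) (ξ x))
        (ReactionCoordinate.stationaryMeasure X π) =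
      ProbabilityTheory.variance (ReactionCoordinate.effectiveIntegrand X Z π ϑ (pL τ))
        (ReactionCoordinate.effectiveMeasure X Z π ξ) := by

  -- `X` is only Lebesgue measurable; the arguments above need a Borel subset of full measure on
  -- which `ξ` and `π` are continuous.
  obtain ⟨X₀, hsub, hX₀, heq⟩ := hsys.nullMeasurableSet.exists_measurable_subset_ae_eq
  have := hsys.isProbabilityMeasure
  have hm := hξ.aemeasurable hX₀ hsub heq π
  have hmap := map_stationaryMeasure hr hX₀ hsub heq hsys.continuousOn_density hξ hZ
  have hc := hξ.continuousOn.mono hsub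
  have hX := stationaryMeasure_compl hX₀ heq π
  rw [← hmap]
  exact ⟨Measure.isProbabilityMeasure_map hm, memLp_map_iff_of_continuousOn hX₀ hX hc hm _ 2,
    variance_map_of_continuousOn hX₀ hX hc hm _⟩
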